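/- Let $(\mathfrak M,\lambda)$ be the Boolean algebra of Borel subsets of $[0,1]$ modulo Lebesgue null sets, with Lebesgue measure $\lambda$, and fix a partition $(B_n)_n$ of $\omega$ into infinite sets, $B_n=\{x^n_0<x^n_1<\cdots\}$. For $A\subseteq\omega$ put $A^n=\{x^n_i: i\in A\}$. A map $\varphi:\mathfrak M\to\mathbb B$ into an algebra of sets with a measure $\mu$ is said to witness that $(\mathfrak M,\lambda)$ is metrically isomorphic to $(\mathbb B,\mu)$ if $M\mapsto[\varphi(M)]$ is a measure preserving isomorphism of $\mathfrak M$ onto $\mathbb B/\mathrm{Null}(\mu)$. Pairs $(\mathbb B^{(\alpha)},\mu^{(\alpha)})$, consisting of a subalgebra of $\mathcal P(\omega)$ and a finitely additive probability measure on it, are obtained for $1\le\alpha<\omega_1$ as follows. * $\alpha=1$: let $\mathcal Z$ be the ideal of sets of asymptotic density $0$ and let $\varphi:\mathfrak M\to\mathcal P(\omega)$ be such that $M\mapsto[\varphi(M)]_{\mathcal Z}$ is a monomorphism into $\mathcal P(\omega)/\mathcal Z$ and each $\varphi(M)$ has asymptotic density $\lambda(M)$. Then $\mathbb B^{(1)}$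 is the algebra generated by $\mathcal Z\cup\{\varphi(M):M\in\mathfrak M\}$, and $\mu^{(1)}$ is asymptotic density. * $\alpha\ge2$: take a non-decreasing sequence of ordinals $1\le\alpha_n<\alpha$ such that every $\beta<\alpha$ satisfies $\beta\le\alpha_n$ for some $n$, pairs $(\mathbb B_n,\mu_n)$ already obtained at the indices $\alpha_n$, and maps $\varphi_n:\mathfrak M\to\mathbb B_n$ witnessing that $(\mathfrak M,\lambda)$ is metrically isomorphic to $(\mathbb B_n,\mu_n)$. For $A\subseteq B_n$ put $\mu_n'(A)=\mu_n(\{i:x^n_i\in A\})$. Then $\mathbb B^{(\alpha)}$ is the algebra generated by all sets $A\subseteq\omega$ such that $A\cap B_n\in\{C^n:C\in\mathbb B_n\}$ for all $n$ and $\lim_n\mu_n'(A\cap B_n)=1$, together with all sets $\bigcup_n\varphi_n(M)^n$ with $M\in\mathfrak M$; and $\mu^{(\alpha)}(A)=\lim_n\mu'_n(A\cap B_n)$. Let $K=K^{(\alpha)}$ be the Stone space of $\mathbb B^{(\alpha)}$ (elements of the algebra are identified with clopen subsets of $K$), let $\mu=\mu^{(\alpha)}$, and let $R\subseteq K$ be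 the support of $\mu$, i.e. the set of ultrafilters all of whose members have positive measure. If $\alpha=1$, let $B_n$ from now on denote the singleton $\{n\}$. Let $\widehat\bigcup_n B_n$ be the union in $K$ of the clopen sets corresponding to the $B_n$. Then, for every $1\le\alpha<\omega_1$ and all choices above, every countable set $V\subseteq K$ disjoint from $\widehat\bigcup_n B_n\cup R$ is contained in a closed extremely disconnected subset $E$ of $K$ (that is, in the subspace $E$ closures of open sets are open). -/

import Mathlib

open Set Filter Topology MeasureTheory

/-- The setoid on Borel subsets of the unit interval: equality up to a Lebesgue null set. -/
def borelSetoid : Setoid {s : Set unitInterval // MeasurableSet s} where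
  r s t := (s : Set unitInterval) =ᵐ[volume] (t : Set unitInterval)
  iseqv := ⟨fun _ => ae_eq_refl _, fun h => h.symm, fun h h' => h.trans h'⟩

/-- The random algebra `𝔐`: Borel subsets of the unit interval modulo Lebesgue null sets. -/
def RandomAlgebra : Type := Quotient borelSetoid

namespace RandomAlgebra

/-- The meet in `𝔐`, induced by the intersection of Borel sets. -/
def inter : RandomAlgebra → RandomAlgebra → RandomAlgebra :=
  Quotient.map₂ (fun s t => ⟨s.1 ∩ t.1, s.2.inter t.2⟩)
    (fun _ _ h _ _ h' => EventuallyEq.inter h h')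

/-- The complement in `𝔐`, induced by the complement of Borel sets. -/
def compl : RandomAlgebra → RandomAlgebra :=
  Quotient.map (fun s => ⟨s.1ᶜ, s.2.compl⟩) (fun _ _ h => EventuallyEq.compl h)

/-- The Lebesgue measure `λ` on `𝔐`. -/
noncomputable def leb : RandomAlgebra → ℝ :=
  Quotient.lift (fun s => (volume : Measure unitInterval).real s.1)
    (fun _ _ h => measureReal_congr h)

end RandomAlgebra

/-- A subalgebra of `𝒫(ω)` together with a real valued set function. Only the values of `meas` on
members of `alg` are ever used. -/
structure MeasuredAlgebra where
  /-- The algebra of sets. -/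
  alg : BooleanSubalgebra (Set ℕ)
  /-- The (finitely additive) measure. -/
  meas : Set ℕ → ℝ

/-- `φ : 𝔐 → 𝔹` witnesses that `(𝔐, λ)` is metrically isomorphic to `(𝔹, μ)`: the map
`M ↦ [φ M]` modulo `Null(μ)` is a measure preserving isomorphism of `𝔐` onto `𝔹 / Null(μ)`.
Two members of `𝔹` are equal modulo `Null(μ)` iff their symmetric difference has measure zero. -/
structure IsMetricIso (φ : RandomAlgebra → Set ℕ) (X : MeasuredAlgebra) : Prop where
  mem : ∀ M, φ M ∈ X.alg
  meas_eq : ∀ M, X.meas (φ M) = M.leb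
  map_inter : ∀ M N, X.meas (symmDiff (φ (M.inter N)) (φ M ∩ φ N)) = 0
  map_compl : ∀ M, X.meas (symmDiff (φ M.compl) (φ M)ᶜ) = 0
  bijective : ∀ A ∈ X.alg, ∃! M, X.meas (symmDiff A (φ M)) = 0

/-! ### The first stage: asymptotic density -/

/-- `|A ∩ {0, …, n}| / (n + 1)`. -/
noncomputable def densityRatio (A : Set ℕ) (n : ℕ) : ℝ :=
  ((A ∩ Set.Iic n).ncard : ℝ) / ((n : ℝ) + 1)

/-- `A` has asymptotic density `d`. -/
def HasDensity (A : Set ℕ) (d : ℝ) : Prop := Tendsto (densityRatio A) atTop (𝓝 d)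

/-- `φ : 𝔐 → 𝒟` takes values in the sets with asymptotic density, `d(φ M) = λ(M)`, and
`M ↦ [φ M]` is a monomorphism of `𝔐` into `𝒫(ω)` modulo the ideal of density zero sets. -/
structure IsDensityEmbedding (φ : RandomAlgebra → Set ℕ) : Prop where
  density : ∀ M, HasDensity (φ M) M.leb
  map_inter : ∀ M N, HasDensity (symmDiff (φ (M.inter N)) (φ M ∩ φ N)) 0
  map_compl : ∀ M, HasDensity (symmDiff (φ M.compl) (φ M)ᶜ) 0
  injective : ∀ M N, HasDensity (symmDiff (φ M) (φ N)) 0 → M = N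

/-- The algebra generated by the density zero sets and the sets `φ M`, with the measure
given by asymptotic density. -/
noncomputable def densityAlgebra (φ : RandomAlgebra → Set ℕ) : MeasuredAlgebra where
  alg := BooleanSubalgebra.closure ({A | HasDensity A 0} ∪ Set.range φ)
  meas A := limUnder atTop (densityRatio A)

/-! ### The canonical construction over a partition `(B n)` of `ω` into infinite sets -/

/-- `B n = {x n 0 < x n 1 < …}`: the increasing enumeration of `B n`. -/
noncomputable def enumB (B : ℕ → Set ℕ) (n i : ℕ) : ℕ := Nat.nth (fun k => k ∈ B n) i

/-- The copy `A^n = {x n i : i ∈ A}` of `A` inside `B n`. -/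
def copyIn (B : ℕ → Set ℕ) (n : ℕ) (A : Set ℕ) : Set ℕ := enumB B n '' A

/-- The transported measure `μ'_n (A) = μ_n {i : x n i ∈ A}` (for `A ⊆ B n`). -/
def copyMeas (B : ℕ → Set ℕ) (X : ℕ → MeasuredAlgebra) (n : ℕ) (A : Set ℕ) : ℝ :=
  (X n).meas {i | enumB B n i ∈ A}

/-- The family `ℱ` of all `A ⊆ ω` such that `A ∩ B n` is the copy in `B n` of a member of `𝔹_n`,
for every `n`, and `μ'_n (A ∩ B n) → 1`. -/
def familyF (B : ℕ → Set ℕ) (X : ℕ → MeasuredAlgebra) : Set (Set ℕ) :=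
  {A | (∀ n, ∃ C ∈ (X n).alg, A ∩ B n = copyIn B n C) ∧
    Tendsto (fun n => copyMeas B X n (A ∩ B n)) atTop (𝓝 1)}

/-- The family `ℱ'` of all sets `⋃ n, (φ_n M)^n` with `M ∈ 𝔐`. -/
def familyF' (B : ℕ → Set ℕ) (φ : ℕ → RandomAlgebra → Set ℕ) : Set (Set ℕ) :=
  Set.range (fun M : RandomAlgebra => ⋃ n, copyIn B n (φ n M))

/-- The pair `(𝔹, μ)` constructed canonically from `(𝔹_n, μ_n)` and the witnesses `φ_n`:
`𝔹` is generated by `ℱ ∪ ℱ'` and `μ(A) = lim μ'_n (A ∩ B n)`. -/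
noncomputable def canonicalPair (B : ℕ → Set ℕ) (X : ℕ → MeasuredAlgebra)
    (φ : ℕ → RandomAlgebra → Set ℕ) : MeasuredAlgebra where
  alg := BooleanSubalgebra.closure (familyF B X ∪ familyF' B φ)
  meas A := limUnder atTop (fun n => copyMeas B X n (A ∩ B n))

/-- `IsStage B α X`: the pair `X = (𝔹, μ)` is (for some admissible choices) the pair of index `α`
in the recursive construction, so that `K^(α)` is the Stone space of `𝔹` and `μ^(α) = μ`.
* Index `1` is the density algebra.
* Index `α ≥ 2` is constructed canonically from pairs of indices `a n < α`, where `a` is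
  non-decreasing and every `β < α` is at most some `a n`; that is, `a` is eventually equal to the
  predecessor of `α` if `α` is a successor, and `a` is cofinal in `α` if `α` is a limit. -/
inductive IsStage (B : ℕ → Set ℕ) : Ordinal.{0} → MeasuredAlgebra → Prop
  | one (φ : RandomAlgebra → Set ℕ) (hφ : IsDensityEmbedding φ) : IsStage B 1 (densityAlgebra φ)
  | step (α : Ordinal.{0}) (a : ℕ → Ordinal.{0}) (X : ℕ → MeasuredAlgebra)
      (φ : ℕ → RandomAlgebra → Set ℕ) (mono : Monotone a) (lt : ∀ n, a n < α)
      (cofinal : ∀ β < α, ∃ n, β ≤ a n) (stage : ∀ n, IsStage B (a n) (X n))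
      (iso : ∀ n, IsMetricIso (φ n) (X n)) : IsStage B α (canonicalPair B X φ)

open Classical in
/-- The bricks directly used at stage `α`: the sets `B n`, except that for `α = 1` they are the
singletons `{n}`. -/
noncomputable def brick (B : ℕ → Set ℕ) (α : Ordinal.{0}) (n : ℕ) : Set ℕ :=
  if α = 1 then {n} else B n

/-! ### Stone spaces -/

/-- The Stone space of a Boolean algebra: its points are the ultrafilters. -/
@[ext] structure Stone (𝔹 : Type*) [BooleanAlgebra 𝔹] where
  /-- The members of the ultrafilter. -/
  sets : Set 𝔹
  top_mem : ⊤ ∈ sets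
  bot_notMem : ⊥ ∉ sets
  inf_mem : ∀ a ∈ sets, ∀ b ∈ sets, a ⊓ b ∈ sets
  mem_of_le : ∀ a ∈ sets, ∀ b, a ≤ b → b ∈ sets
  mem_or_compl_mem : ∀ a, a ∈ sets ∨ aᶜ ∈ sets

/-- The topology of the Stone space, generated by the sets `{u | a ∈ u}`. -/
instance {𝔹 : Type*} [BooleanAlgebra 𝔹] : TopologicalSpace (Stone 𝔹) :=
  TopologicalSpace.generateFrom (Set.range fun a : 𝔹 => {u : Stone 𝔹 | a ∈ u.sets})

namespace MeasuredAlgebra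

/-- The Stone space of the algebra of a pair `(𝔹, μ)`. -/
abbrev Space (X : MeasuredAlgebra) : Type := Stone X.alg

/-- The clopen subset of the Stone space corresponding to a member `A` of the algebra. -/
def hat (X : MeasuredAlgebra) (A : Set ℕ) : Set X.Space :=
  {u | ∃ h : A ∈ X.alg, (⟨A, h⟩ : X.alg) ∈ u.sets}

/-- The support of `μ` in the Stone space: the points all of whose (basic) clopen neighbourhoods
have positive measure. -/
def support (X : MeasuredAlgebra) : Set X.Space :=
  {u | ∀ A ∈ u.sets, 0 < X.meas (A : Set ℕ)}

end MeasuredAlgebra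

/-!
The set `E` is the closure of `V`. The argument is that of "countable subsets of F-spaces are
extremally disconnected": if open sets that are disjoint on `V` are always separated on `V` by a
clopen set, then the closure of `V` is extremally disconnected
(`Stone.extremallyDisconnected_closure`).

To separate, enumerate `V` and choose for every point of `V` in `U` (respectively in `W`) a member
`p i` (respectively `q i`) of the algebra whose clopen set is a neighbourhood of the point inside
`U` (respectively `W`). Subtracting earlier members of the other sequence, all these may be taken
to be disjoint from each other across the two families. Points of `V` lie outside the support, so
the `p i` may be taken null. What is then needed is a pseudo-union of the `p i`: a member `c` of the
algebra inside `⋃ i, p i` that contains each `p i` up to finitely many bricks. As points of `V` avoid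
the bricks, `c` belongs to every point of `V` in `U`, and being disjoint from all `q i` it belongs to
no point of `V` in `W` (`Stone.exists_separating`).

At every stage the measure is the limit of a sequence of finitely additive measures `m n`
(`IsContentSystem`, `IsLimitOf`): the density ratios at stage one, and the transported measures
`μ'_n` at later stages. A pseudo-union is obtained by diagonalizing: on the `n`-th brick take
`p 0 ∪ ⋯ ∪ p (k n)`, where `k n` tends to infinity so slowly that the result is still null in the
limit (`IsContentSystem.exists_pseudoUnion`); it lies in the algebra because all sets that are null
in the limit do. That the limits exist on the whole algebra is because each member agrees with one of
the copies of elements of the random algebra up to a null set (`IsContentSystem.isLimitOf`).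
Recursion over the stages serves only to show that the measures at each stage are finitely additive
probability measures.
-/

/-! ### Countable subsets of Stone spaces -/

namespace Stone

variable {𝔹 : Type*} [BooleanAlgebra 𝔹]

lemma isOpen_basic (a : 𝔹) : IsOpen {u : Stone 𝔹 | a ∈ u.sets} :=
  TopologicalSpace.isOpen_generateFrom_of_mem ⟨a, rfl⟩

lemma notMem_of_disjoint (u : Stone 𝔹) {a b : 𝔹} (h : Disjoint a b) (hb : b ∈ u.sets) :
    a ∉ u.sets := fun ha => u.bot_notMem (h.eq_bot ▸ u.inf_mem a ha b hb)

lemma compl_mem_iff (u : Stone 𝔹) {a : 𝔹} : aᶜ ∈ u.sets ↔ a ∉ u.sets :=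
  ⟨u.notMem_of_disjoint disjoint_compl_right, (u.mem_or_compl_mem a).resolve_left⟩

lemma isClosed_basic (a : 𝔹) : IsClosed {u : Stone 𝔹 | a ∈ u.sets} := by
  refine ⟨?_⟩
  convert isOpen_basic aᶜ using 1
  ext u
  exact u.compl_mem_iff.symm

lemma exists_basic_subset {O : Set (Stone 𝔹)} (hO : IsOpen O) {u : Stone 𝔹} (hu : u ∈ O) :
    ∃ a ∈ u.sets, {v : Stone 𝔹 | a ∈ v.sets} ⊆ O := by
  induction hO with
  | basic s hs =>
    obtain ⟨a, rfl⟩ := hs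
    exact ⟨a, hu, subset_rfl⟩
  | univ => exact ⟨⊤, u.top_mem, subset_univ _⟩
  | inter s t _ _ ihs iht =>
    obtain ⟨a, ha, has⟩ := ihs hu.1
    obtain ⟨b, hb, hbt⟩ := iht hu.2
    exact ⟨a ⊓ b, u.inf_mem a ha b hb, fun v hv =>
      ⟨has (v.mem_of_le _ hv _ inf_le_left), hbt (v.mem_of_le _ hv _ inf_le_right)⟩⟩
  | sUnion S _ ih =>
    obtain ⟨s, hs, hus⟩ := hu
    obtain ⟨a, ha, has⟩ := ih s hs hus
    exact ⟨a, ha, has.trans (subset_sUnion_of_mem hs)⟩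

/-- `Null` is a class of elements, closed downwards, such that every sequence in it has a
pseudo-union, as seen from `V`: an element `c` inside every upper bound of the sequence which
belongs to each point of `V` containing some member of the sequence. If every point of `V` contains
a null element and `V` is countable, then open sets that are disjoint on `V` can be separated on
`V` by a clopen set. -/
lemma exists_separating {V : Set (Stone 𝔹)} (hV : V.Countable) {Null : 𝔹 → Prop}
    (bot : Null ⊥) (mono : ∀ a b, a ≤ b → Null b → Null a)
    (hN : ∀ v ∈ V, ∃ a ∈ v.sets, Null a)
    (hP : ∀ a : ℕ → 𝔹, (∀ i, Null (a i)) → ∃ c : 𝔹,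
      (∀ b, (∀ i, Disjoint (a i) b) → Disjoint c b) ∧
      ∀ i, ∀ v ∈ V, a i ∈ v.sets → c ∈ v.sets)
    {U W : Set (Stone 𝔹)} (hU : IsOpen U) (hW : IsOpen W) (hUW : ∀ v ∈ V, v ∈ U → v ∉ W) :
    ∃ c : 𝔹, ∀ v ∈ V, (v ∈ U → c ∈ v.sets) ∧ (v ∈ W → c ∉ v.sets) := by
  rcases V.eq_empty_or_nonempty with rfl | hne
  · exact ⟨⊥, by simp⟩
  obtain ⟨e, rfl⟩ := hV.exists_eq_range hne
  have hp : ∀ i, ∃ a, Null a ∧ (∀ v : Stone 𝔹, a ∈ v.sets → v ∈ U) ∧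
      (e i ∈ U → a ∈ (e i).sets) := fun i => by
    by_cases h : e i ∈ U
    · obtain ⟨a, ha, haU⟩ := exists_basic_subset hU h
      obtain ⟨z, hz, hz0⟩ := hN _ ⟨i, rfl⟩
      exact ⟨a ⊓ z, mono _ _ inf_le_right hz0, fun v hv => haU (v.mem_of_le _ hv _ inf_le_left),
        fun _ => (e i).inf_mem _ ha _ hz⟩
    · exact ⟨⊥, bot, fun v hv => (v.bot_notMem hv).elim, fun h' => (h h').elim⟩
  have hq : ∀ i, ∃ a, (∀ v : Stone 𝔹, a ∈ v.sets → v ∈ W) ∧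
      (e i ∈ W → a ∈ (e i).sets) := fun i => by
    by_cases h : e i ∈ W
    · obtain ⟨a, ha, haU⟩ := exists_basic_subset hW h
      exact ⟨a, fun v hv => haU hv, fun _ => ha⟩
    · exact ⟨⊥, fun v hv => (v.bot_notMem hv).elim, fun h' => (h h').elim⟩
  choose p hp0 hpU hpe using hp
  choose q hqW hqe using hq
  -- Subtracting from each `p i` and `q i` the earlier members of the other sequence makes the
  -- two sequences disjoint from each other.
  let a : ℕ → 𝔹 := fun i => p i ⊓ (Finset.range (i + 1)).inf fun j => (q j)ᶜ
  let b : ℕ → 𝔹 := fun i => q i ⊓ (Finset.range (i + 1)).inf fun j => (p j)ᶜ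
  have hab : ∀ i j, Disjoint (a i) (b j) := fun i j => by
    rcases le_total j i with h | h
    · exact (disjoint_compl_left (a := q j)).mono
        (inf_le_right.trans (Finset.inf_le (Finset.mem_range.2 (by lia)))) inf_le_left
    · exact (disjoint_compl_right (a := p i)).mono inf_le_left
        (inf_le_right.trans (Finset.inf_le (Finset.mem_range.2 (by lia))))
  obtain ⟨c, hc, hcV⟩ := hP a fun i => mono _ _ inf_le_left (hp0 i)
  have hinf : ∀ (u : Stone 𝔹) (s : Finset ℕ) (r : ℕ → 𝔹), (∀ j, r j ∉ u.sets) →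
      s.inf (fun j => (r j)ᶜ) ∈ u.sets := fun u s r hr =>
    Finset.inf_induction (p := (· ∈ u.sets)) u.top_mem u.inf_mem
      fun j _ => u.compl_mem_iff.2 (hr j)
  refine ⟨c, ?_⟩
  rintro _ ⟨i, rfl⟩
  refine ⟨fun hi => hcV i _ ⟨i, rfl⟩ ?_, fun hi => ?_⟩
  · exact (e i).inf_mem _ (hpe i hi) _
      (hinf _ _ _ fun j hj => hUW _ ⟨i, rfl⟩ hi (hqW j _ hj))
  · refine (e i).notMem_of_disjoint (hc (b i) fun j => hab j i) ((e i).inf_mem _ (hqe i hi) _ ?_)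
    exact hinf _ _ _ fun j hj => hUW _ ⟨i, rfl⟩ (hpU j _ hj) hi

/-- If disjoint traces of open sets on `V` are separated on `V` by clopen sets, then disjoint open
subsets of `closure V` have disjoint closures, so `closure V` is extremally disconnected. -/
lemma extremallyDisconnected_closure {V : Set (Stone 𝔹)}
    (hsep : ∀ U W : Set (Stone 𝔹), IsOpen U → IsOpen W → (∀ v ∈ V, v ∈ U → v ∉ W) →
      ∃ c : 𝔹, ∀ v ∈ V, (v ∈ U → c ∈ v.sets) ∧ (v ∈ W → c ∉ v.sets)) :
    ExtremallyDisconnected (closure V) := by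
  refine ⟨fun U₀ hU₀ => ?_⟩
  obtain ⟨U, hU, hUU⟩ := isOpen_induced_iff.1 hU₀
  obtain ⟨W, hW, hWW⟩ := isOpen_induced_iff.1 (isClosed_closure (s := U₀)).isOpen_compl
  have hdisj : ∀ v ∈ V, v ∈ U → v ∉ W := fun v hv hvU hvW => by
    have h1 : (⟨v, subset_closure hv⟩ : closure V) ∈ U₀ := hUU ▸ hvU
    have h2 : (⟨v, subset_closure hv⟩ : closure V) ∈ (closure U₀)ᶜ := hWW ▸ hvW
    exact h2 (subset_closure h1)
  obtain ⟨c, hc⟩ := hsep U W hU hW hdisj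
  have hdense : ∀ O : Set (Stone 𝔹), IsOpen O → ∀ a : 𝔹, (∀ v ∈ V, v ∈ O → a ∈ v.sets) →
      ∀ x ∈ closure V, x ∈ O → a ∈ x.sets := fun O hO a h x hx hxO => by
    have : x ∈ closure (O ∩ V) := hO.inter_closure ⟨hxO, hx⟩
    exact closure_minimal (fun v hv => h v hv.2 hv.1) (isClosed_basic a) this
  have hUc : ∀ x : closure V, x ∈ U₀ → c ∈ x.1.sets := fun x hx =>
    hdense U hU c (fun v hv => (hc v hv).1) x.1 x.2 (by rw [← hUU] at hx; exact hx)
  have hWc : ∀ x : closure V, x ∉ closure U₀ → c ∉ x.1.sets := fun x hx =>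
    x.1.compl_mem_iff.1 <| hdense W hW cᶜ
      (fun v hv hvW => v.compl_mem_iff.2 ((hc v hv).2 hvW)) x.1 x.2
      (by have : x ∈ (closure U₀)ᶜ := hx
          rw [← hWW] at this; exact this)
  have : closure U₀ = (fun x : closure V => x.1) ⁻¹' {u : Stone 𝔹 | c ∈ u.sets} := by
    apply Subset.antisymm
    · exact closure_minimal hUc ((isClosed_basic c).preimage continuous_subtype_val)
    · intro x hx
      by_contra h
      exact hWc x h hx
  rw [this]
  exact (isOpen_basic c).preimage continuous_subtype_val

end Stone

/-! ### Finitely additive probability measures -/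

/-- `m` restricts to a finitely additive probability measure on the algebra `𝒜`. -/
structure IsContent (𝒜 : BooleanSubalgebra (Set ℕ)) (m : Set ℕ → ℝ) : Prop where
  nonneg : ∀ A ∈ 𝒜, 0 ≤ m A
  univ : m Set.univ = 1
  union : ∀ A ∈ 𝒜, ∀ A' ∈ 𝒜, Disjoint A A' → m (A ∪ A') = m A + m A'

lemma BooleanSubalgebra.symmDiff_mem {𝒜 : BooleanSubalgebra (Set ℕ)} {A A' : Set ℕ} (h : A ∈ 𝒜)
    (h' : A' ∈ 𝒜) : symmDiff A A' ∈ 𝒜 :=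
  𝒜.sup_mem (𝒜.sdiff_mem h h') (𝒜.sdiff_mem h' h)

namespace IsContent

variable {𝒜 : BooleanSubalgebra (Set ℕ)} {m : Set ℕ → ℝ} {A P Q : Set ℕ}

lemma empty (h : IsContent 𝒜 m) : m ∅ = 0 := by
  have := h.union ∅ 𝒜.bot_mem ∅ 𝒜.bot_mem disjoint_bot_left
  simpa using this

lemma compl (h : IsContent 𝒜 m) (hA : A ∈ 𝒜) : m Aᶜ = 1 - m A := by
  have := h.union A hA Aᶜ (𝒜.compl_mem hA) disjoint_compl_right
  rw [union_compl_self, h.univ] at this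
  linarith

lemma le_add (h : IsContent 𝒜 m) (hA : A ∈ 𝒜) (hP : P ∈ 𝒜) (hQ : Q ∈ 𝒜) (hs : A ⊆ P ∪ Q) :
    m A ≤ m P + m Q := by
  have h1 := h.union (A ∩ P) (𝒜.inf_mem hA hP) (A \ P) (𝒜.sdiff_mem hA hP)
    (disjoint_sdiff_self_right.mono_left inter_subset_right)
  have h2 := h.union (A ∩ P) (𝒜.inf_mem hA hP) (P \ A) (𝒜.sdiff_mem hP hA)
    (disjoint_sdiff_self_right.mono_left inter_subset_left)
  have h3 := h.union (A \ P) (𝒜.sdiff_mem hA hP) (Q \ (A \ P))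
    (𝒜.sdiff_mem hQ (𝒜.sdiff_mem hA hP)) disjoint_sdiff_self_right
  rw [inter_union_sdiff] at h1
  rw [inter_comm, inter_union_sdiff] at h2
  rw [union_sdiff_cancel fun x hx => (hs hx.1).resolve_left hx.2] at h3
  rw [inter_comm] at h1
  have h4 := h.nonneg _ (𝒜.sdiff_mem hP hA)
  have h5 := h.nonneg _ (𝒜.sdiff_mem hQ (𝒜.sdiff_mem hA hP))
  linarith

lemma mono (h : IsContent 𝒜 m) (hA : A ∈ 𝒜) (hP : P ∈ 𝒜) (hs : A ⊆ P) : m A ≤ m P := by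
  have := h.le_add hA hP 𝒜.bot_mem (by simpa using hs)
  have h0 : m ⊥ = 0 := h.empty
  linarith

lemma abs_sub_le (h : IsContent 𝒜 m) (hA : A ∈ 𝒜) (hP : P ∈ 𝒜) :
    |m A - m P| ≤ m (symmDiff A P) := by
  have hs := BooleanSubalgebra.symmDiff_mem hA hP
  have h1 := h.le_add hA hP hs fun x hx => by
    by_cases hxP : x ∈ P
    · exact Or.inl hxP
    · exact Or.inr (Or.inl ⟨hx, hxP⟩)
  have h2 := h.le_add hP hA hs fun x hx => by
    by_cases hxA : x ∈ A
    · exact Or.inl hxA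
    · exact Or.inr (Or.inr ⟨hx, hxA⟩)
  rw [abs_le]
  constructor <;> linarith

end IsContent

/-! ### Limits of sequences of measures -/

/-- Given a sequence of null sequences, a slowly growing diagonal is still null. -/
lemma exists_monotone_diagonal {f : ℕ → ℕ → ℝ} (h0 : ∀ k n, 0 ≤ f k n)
    (hf : ∀ k, Tendsto (f k) atTop (𝓝 0)) :
    ∃ k : ℕ → ℕ, Monotone k ∧ Tendsto k atTop atTop ∧
      Tendsto (fun n => f (k n) n) atTop (𝓝 0) := by
  classical
  let P : ℕ → ℕ → Prop := fun n k => ∀ m ≥ n, f k m ≤ 1 / ((k : ℝ) + 1)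
  let k : ℕ → ℕ := fun n => Nat.findGreatest (P n) n
  have hk : Tendsto k atTop atTop := by
    refine tendsto_atTop.2 fun j => ?_
    obtain ⟨N, hN⟩ := eventually_atTop.1
      ((hf j).eventually_le_const (show (0 : ℝ) < 1 / ((j : ℝ) + 1) by positivity))
    filter_upwards [eventually_ge_atTop (max N j)] with n hn
    exact Nat.le_findGreatest (le_of_max_le_right hn)
      fun m hm => hN m ((le_of_max_le_left hn).trans hm)
  refine ⟨k, fun n n' h => Nat.findGreatest_mono (fun j hj m hm => hj m (h.trans hm)) h, hk, ?_⟩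
  refine squeeze_zero' (.of_forall fun n => h0 _ _) ?_
    (tendsto_one_div_add_atTop_nhds_zero_nat.comp hk)
  filter_upwards [hk.eventually_ge_atTop 1] with n hn
  exact Nat.findGreatest_of_ne_zero (P := P n) (n := n) rfl (by change k n ≠ 0; lia) n le_rfl

/-- A sequence of finitely additive measures `m n` on an algebra `𝒜`, adapted to a partition of
`ω` into bricks `b n`: each brick is null in the limit, `m n` does not see the bricks after the
`n`-th one, and traces on the bricks of members of `𝒜` can be glued together. Asymptotic density,
with singleton bricks, and the limit measures of the canonical construction are both limits of such
sequences. -/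
structure IsContentSystem (𝒜 : BooleanSubalgebra (Set ℕ)) (m : ℕ → Set ℕ → ℝ) (b : ℕ → Set ℕ) :
    Prop where
  content : ∀ n, IsContent 𝒜 (m n)
  le_of_inter_subset : ∀ n, ∀ A ∈ 𝒜, ∀ A' ∈ 𝒜, (∀ j ≤ n, A ∩ b j ⊆ A') → m n A ≤ m n A'
  glue : ∀ s : ℕ → Set ℕ, (∀ n, s n ∈ 𝒜) → (⋃ n, b n ∩ s n) ∈ 𝒜
  brick_mem : ∀ j, b j ∈ 𝒜
  tendsto_brick : ∀ j, Tendsto (fun n => m n (b j)) atTop (𝓝 0)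
  disjoint : Pairwise (fun i j => Disjoint (b i) (b j))
  cover : (⋃ n, b n) = Set.univ

namespace IsContentSystem

variable {𝒜 : BooleanSubalgebra (Set ℕ)} {m : ℕ → Set ℕ → ℝ} {b : ℕ → Set ℕ}

/-- The null ideal of a limit measure is a P-ideal modulo finite unions of bricks, with the
pseudo-union inside the union. -/
lemma exists_pseudoUnion (h : IsContentSystem 𝒜 m b) {a : ℕ → Set ℕ} (ha : ∀ i, a i ∈ 𝒜)
    (hn : ∀ i, Tendsto (fun n => m n (a i)) atTop (𝓝 0)) :
    ∃ c ∈ 𝒜, Tendsto (fun n => m n c) atTop (𝓝 0) ∧ c ⊆ ⋃ i, a i ∧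
      ∀ i, ∃ N, a i ⊆ c ∪ ⋃ j ∈ Finset.range N, b j := by
  have hs : ∀ k, accumulate a k ∈ 𝒜 ∧
      Tendsto (fun n => m n (accumulate a k)) atTop (𝓝 0) := fun k => by
    induction k with
    | zero => simpa [accumulate_zero_nat] using ⟨ha 0, hn 0⟩
    | succ k ih =>
      have hmem : accumulate a (k + 1) ∈ 𝒜 := by
        rw [accumulate_succ]
        exact 𝒜.sup_mem ih.1 (ha _)
      refine ⟨hmem, squeeze_zero (fun n => (h.content n).nonneg _ hmem)
        (fun n => (h.content n).le_add hmem ih.1 (ha (k + 1)) (accumulate_succ a k).subset) ?_⟩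
      simpa using ih.2.add (hn (k + 1))
  obtain ⟨k, hkm, hkt, hk0⟩ := exists_monotone_diagonal
    (f := fun k n => m n (accumulate a k)) (fun k n => (h.content n).nonneg _ (hs k).1)
    fun k => (hs k).2
  have hc := h.glue (fun n => accumulate a (k n)) fun n => (hs _).1
  refine ⟨_, hc, squeeze_zero (fun n => (h.content n).nonneg _ hc) (fun n => ?_) hk0, ?_, ?_⟩
  · refine h.le_of_inter_subset n _ hc _ (hs _).1 fun j hj x hx => ?_
    obtain ⟨i, hi, hxi⟩ := mem_iUnion.1 hx.1
    have : i = j := by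
      by_contra hij
      exact disjoint_left.1 (h.disjoint hij) hi hx.2
    subst this
    exact monotone_accumulate (hkm hj) hxi
  · refine iUnion_subset fun n x hx => ?_
    obtain ⟨j, -, hj⟩ := mem_accumulate.1 hx.2
    exact mem_iUnion.2 ⟨j, hj⟩
  · intro i
    obtain ⟨N, hN⟩ := eventually_atTop.1 (hkt.eventually_ge_atTop i)
    refine ⟨N, fun x hx => ?_⟩
    obtain ⟨j, hj⟩ := mem_iUnion.1 (h.cover ▸ mem_univ x)
    rcases lt_or_ge j N with hjN | hjN
    · exact Or.inr (mem_biUnion (Finset.mem_coe.2 (Finset.mem_range.2 hjN)) hj)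
    · exact Or.inl (mem_iUnion.2 ⟨j, hj, mem_accumulate.2 ⟨i, hN j hjN, hx⟩⟩)

end IsContentSystem

/-- The pair `X` carries the limit of a sequence of measures adapted to the bricks `b`, and its
algebra contains all sets that are null in the limit. -/
structure IsLimitOf (X : MeasuredAlgebra) (𝒜 : BooleanSubalgebra (Set ℕ)) (m : ℕ → Set ℕ → ℝ)
    (b : ℕ → Set ℕ) : Prop where
  system : IsContentSystem 𝒜 m b
  alg_le : X.alg ≤ 𝒜
  tendsto_meas : ∀ A ∈ X.alg, Tendsto (fun n => m n A) atTop (𝓝 (X.meas A))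
  mem_of_null : ∀ A ∈ 𝒜, Tendsto (fun n => m n A) atTop (𝓝 0) → A ∈ X.alg

namespace IsLimitOf

variable {X : MeasuredAlgebra} {𝒜 : BooleanSubalgebra (Set ℕ)} {m : ℕ → Set ℕ → ℝ}
  {b : ℕ → Set ℕ}

lemma isContent (h : IsLimitOf X 𝒜 m b) : IsContent X.alg X.meas where
  nonneg A hA := ge_of_tendsto' (h.tendsto_meas A hA)
    fun n => (h.system.content n).nonneg A (h.alg_le hA)
  univ := by
    refine tendsto_nhds_unique (h.tendsto_meas Set.univ X.alg.top_mem) ?_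
    simp only [(h.system.content _).univ, tendsto_const_nhds]
  union A hA A' hA' hd := by
    refine tendsto_nhds_unique (h.tendsto_meas (A ∪ A') (X.alg.sup_mem hA hA')) ?_
    simp only [(h.system.content _).union A (h.alg_le hA) A' (h.alg_le hA') hd]
    exact (h.tendsto_meas A hA).add (h.tendsto_meas A' hA')

lemma exists_closed_extremallyDisconnected (h : IsLimitOf X 𝒜 m b) {V : Set X.Space}
    (hV : V.Countable) (hVdisj : Disjoint V ((⋃ n, X.hat (b n)) ∪ X.support)) :
    ∃ E : Set X.Space, IsClosed E ∧ ExtremallyDisconnected E ∧ V ⊆ E := by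
  refine ⟨closure V, isClosed_closure, ?_, subset_closure⟩
  refine Stone.extremallyDisconnected_closure fun U W hU hW hUW =>
    Stone.exists_separating hV (Null := fun A : X.alg => X.meas (A : Set ℕ) = 0)
      h.isContent.empty ?_ ?_ ?_ hU hW hUW
  · intro A A' hle h0
    exact le_antisymm (h0 ▸ h.isContent.mono A.2 A'.2 hle) (h.isContent.nonneg _ A.2)
  · intro v hv
    have hns : v ∉ X.support := fun hs => disjoint_left.1 hVdisj hv (Or.inr hs)
    simp only [MeasuredAlgebra.support, mem_ofPred_eq, not_forall, not_lt] at hns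
    obtain ⟨A, hA, hA0⟩ := hns
    exact ⟨A, hA, le_antisymm hA0 (h.isContent.nonneg _ A.2)⟩
  · intro a ha
    obtain ⟨c, hc, hc0, hsub, hN⟩ := h.system.exists_pseudoUnion
      (a := fun i => (a i : Set ℕ)) (fun i => h.alg_le (a i).2)
      fun i => ha i ▸ h.tendsto_meas _ (a i).2
    refine ⟨⟨c, h.mem_of_null c hc hc0⟩, fun d hd => ?_, fun i v hv hi => ?_⟩
    · refine disjoint_iff.2 (Subtype.ext ?_)
      refine eq_empty_of_forall_notMem fun x hx => ?_
      obtain ⟨i, hxi⟩ := mem_iUnion.1 (hsub hx.1)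
      have : (a i : Set ℕ) ∩ d = ∅ := congrArg Subtype.val (hd i).eq_bot
      exact notMem_empty x (this ▸ ⟨hxi, hx.2⟩)
    · obtain ⟨N, hN⟩ := hN i
      have hb : ∀ j, b j ∈ X.alg := fun j =>
        h.mem_of_null _ (h.system.brick_mem j) (h.system.tendsto_brick j)
      have hbv : ∀ j, (⟨b j, hb j⟩ : X.alg) ∉ v.sets := fun j hj =>
        disjoint_left.1 hVdisj hv (Or.inl (mem_iUnion.2 ⟨j, hb j, hj⟩))
      have hinf : (Finset.range N).inf (fun j => (⟨b j, hb j⟩ : X.alg)ᶜ) ∈ v.sets :=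
        Finset.inf_induction (p := (· ∈ v.sets)) v.top_mem v.inf_mem
          fun j _ => v.compl_mem_iff.2 (hbv j)
      refine v.mem_of_le _ (v.inf_mem _ hi _ hinf) _ fun x hx => ?_
      refine (hN hx.1).resolve_right fun hx' => ?_
      obtain ⟨j, hj, hxj⟩ := mem_iUnion₂.1 hx'
      have hle : (Finset.range N).inf (fun j => (⟨b j, hb j⟩ : X.alg)ᶜ) ≤ (⟨b j, hb j⟩ : X.alg)ᶜ :=
        Finset.inf_le hj
      exact hle hx.2 hxj

end IsLimitOf

/-! ### Algebras generated by null sets and approximate copies of the random algebra -/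

/-- The members of `𝒜` which are equal, up to sets that are null in the limit, to one of the
sets `ψ M`. -/
def approxAlgebra {𝒜 : BooleanSubalgebra (Set ℕ)} {m : ℕ → Set ℕ → ℝ}
    (hm : ∀ n, IsContent 𝒜 (m n)) {ψ : RandomAlgebra → Set ℕ} (hψ : ∀ M, ψ M ∈ 𝒜)
    (hleb : ∀ M, Tendsto (fun n => m n (ψ M)) atTop (𝓝 M.leb))
    (hinter : ∀ M N, Tendsto (fun n => m n (symmDiff (ψ (M.inter N)) (ψ M ∩ ψ N))) atTop (𝓝 0))
    (hcompl : ∀ M, Tendsto (fun n => m n (symmDiff (ψ M.compl) (ψ M)ᶜ)) atTop (𝓝 0)) :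
    BooleanSubalgebra (Set ℕ) :=
  have hC : ∀ A, (A ∈ 𝒜 ∧ ∃ M, Tendsto (fun n => m n (symmDiff A (ψ M))) atTop (𝓝 0)) →
      (Aᶜ ∈ 𝒜 ∧ ∃ M, Tendsto (fun n => m n (symmDiff Aᶜ (ψ M))) atTop (𝓝 0)) := by
    rintro A ⟨hA, M, hM⟩
    have hA' := 𝒜.compl_mem hA
    have hs := BooleanSubalgebra.symmDiff_mem hA' (hψ M.compl)
    refine ⟨hA', M.compl, squeeze_zero (fun n => (hm n).nonneg _ hs) (fun n =>
      (hm n).le_add hs (BooleanSubalgebra.symmDiff_mem hA (hψ M)) (BooleanSubalgebra.symmDiff_mem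
        (hψ M.compl) (𝒜.compl_mem (hψ M))) ?_) (by simpa using hM.add (hcompl M))⟩
    intro x
    simp only [mem_union, mem_symmDiff, mem_compl_iff]
    tauto
  have hI : ∀ A, (A ∈ 𝒜 ∧ ∃ M, Tendsto (fun n => m n (symmDiff A (ψ M))) atTop (𝓝 0)) →
      ∀ A', (A' ∈ 𝒜 ∧ ∃ M, Tendsto (fun n => m n (symmDiff A' (ψ M))) atTop (𝓝 0)) →
      (A ∩ A' ∈ 𝒜 ∧ ∃ M, Tendsto (fun n => m n (symmDiff (A ∩ A') (ψ M))) atTop (𝓝 0)) := by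
    rintro A ⟨hA, M, hM⟩ A' ⟨hA', M', hM'⟩
    have hAA := 𝒜.inf_mem hA hA'
    have hs := BooleanSubalgebra.symmDiff_mem hAA (hψ (M.inter M'))
    have h1 := BooleanSubalgebra.symmDiff_mem hA (hψ M)
    have h2 := BooleanSubalgebra.symmDiff_mem hA' (hψ M')
    have h3 := BooleanSubalgebra.symmDiff_mem (hψ (M.inter M')) (𝒜.inf_mem (hψ M) (hψ M'))
    refine ⟨hAA, M.inter M', squeeze_zero (fun n => (hm n).nonneg _ hs) (fun n =>
      ((hm n).le_add hs (𝒜.sup_mem h1 h2) h3 ?_).trans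
        (add_le_add_left ((hm n).le_add (𝒜.sup_mem h1 h2) h1 h2 subset_rfl) _))
        (by simpa using (hM.add hM').add (hinter M M'))⟩
    intro x
    simp only [mem_union, mem_symmDiff, mem_inter_iff, inf_eq_inter, sup_eq_union]
    tauto
  { carrier := {A | A ∈ 𝒜 ∧ ∃ M, Tendsto (fun n => m n (symmDiff A (ψ M))) atTop (𝓝 0)}
    supClosed' := fun A hA A' hA' => by
      have := hC _ (hI _ (hC A hA) _ (hC A' hA'))
      rwa [compl_inter, compl_compl, compl_compl] at this
    infClosed' := fun A hA A' hA' => hI A hA A' hA'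
    compl_mem' := fun {A} hA => hC A hA
    bot_mem' := by
      refine ⟨𝒜.bot_mem, Quotient.mk borelSetoid ⟨∅, MeasurableSet.empty⟩, ?_⟩
      have h0 : RandomAlgebra.leb (Quotient.mk borelSetoid ⟨∅, MeasurableSet.empty⟩) = 0 := by
        simp [RandomAlgebra.leb]
      simpa only [bot_symmDiff, h0] using
        hleb (Quotient.mk borelSetoid ⟨∅, MeasurableSet.empty⟩) }

/-- If the `ψ M` are, in the limit, a measure preserving copy of the random algebra, then an
algebra generated by sets that are null or conull in the limit and by the `ψ M` carries the
limit measure: each of its members differs from some `ψ M` by a null set. -/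
lemma IsContentSystem.isLimitOf {𝒜 : BooleanSubalgebra (Set ℕ)} {m : ℕ → Set ℕ → ℝ}
    {b : ℕ → Set ℕ} (h : IsContentSystem 𝒜 m b) {ψ : RandomAlgebra → Set ℕ} (hψ : ∀ M, ψ M ∈ 𝒜)
    (hleb : ∀ M, Tendsto (fun n => m n (ψ M)) atTop (𝓝 M.leb))
    (hinter : ∀ M N, Tendsto (fun n => m n (symmDiff (ψ (M.inter N)) (ψ M ∩ ψ N))) atTop (𝓝 0))
    (hcompl : ∀ M, Tendsto (fun n => m n (symmDiff (ψ M.compl) (ψ M)ᶜ)) atTop (𝓝 0))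
    {X : MeasuredAlgebra} {S : Set (Set ℕ)} (hX : X.alg = BooleanSubalgebra.closure (S ∪ range ψ))
    (hS : ∀ A ∈ S, A ∈ 𝒜 ∧ (Tendsto (fun n => m n A) atTop (𝓝 0) ∨
      Tendsto (fun n => m n A) atTop (𝓝 1)))
    (hnull : ∀ A ∈ 𝒜, Tendsto (fun n => m n A) atTop (𝓝 0) → A ∈ S ∨ Aᶜ ∈ S)
    (hmeas : ∀ A, X.meas A = limUnder atTop fun n => m n A) :
    IsLimitOf X 𝒜 m b := by
  let D := approxAlgebra h.content hψ hleb hinter hcompl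
  have hD : ∀ A, A ∈ D ↔ (A ∈ 𝒜 ∧ ∃ M, Tendsto (fun n => m n (symmDiff A (ψ M))) atTop (𝓝 0)) :=
    fun A => Iff.rfl
  have hnullD : ∀ A ∈ 𝒜, Tendsto (fun n => m n A) atTop (𝓝 0) → A ∈ D := by
    intro A hA h0
    obtain ⟨-, M, hM⟩ := (hD _).1 D.bot_mem
    simp only [bot_symmDiff] at hM
    have hs := BooleanSubalgebra.symmDiff_mem hA (hψ M)
    refine (hD A).2 ⟨hA, M, squeeze_zero (fun n => (h.content n).nonneg _ hs) (fun n =>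
      (h.content n).le_add hs hA (hψ M) symmDiff_le_sup) ?_⟩
    simpa using h0.add hM
  have hle : X.alg ≤ D := by
    rw [hX, BooleanSubalgebra.closure_le]
    rintro A (hA | ⟨M, rfl⟩)
    · obtain ⟨hA𝒜, h0 | h1⟩ := hS A hA
      · exact hnullD A hA𝒜 h0
      · refine BooleanSubalgebra.compl_mem_iff.1 (hnullD Aᶜ (𝒜.compl_mem hA𝒜) ?_)
        simp only [(h.content _).compl hA𝒜]
        simpa using h1.const_sub 1
    · refine (hD _).2 ⟨hψ M, M, ?_⟩
      simp only [symmDiff_self]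
      exact tendsto_const_nhds.congr fun n => (h.content n).empty.symm
  refine ⟨h, fun A hA => ((hD A).1 (hle hA)).1, fun A hA => ?_, fun A hA h0 => ?_⟩
  · obtain ⟨hA𝒜, M, hM⟩ := (hD A).1 (hle hA)
    have hsub : Tendsto (fun n => m n A - m n (ψ M)) atTop (𝓝 0) :=
      squeeze_zero_norm (fun n => (h.content n).abs_sub_le hA𝒜 (hψ M)) hM
    have hlim : Tendsto (fun n => m n A) atTop (𝓝 M.leb) := by
      simpa using hsub.add (hleb M)
    rw [hmeas, hlim.limUnder_eq]
    exact hlim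
  · rw [hX]
    rcases hnull A hA h0 with hAS | hAS
    · exact BooleanSubalgebra.subset_closure (Or.inl hAS)
    · exact BooleanSubalgebra.compl_mem_iff.1 (BooleanSubalgebra.subset_closure (Or.inl hAS))

/-! ### Asymptotic density -/

lemma isContentSystem_densityRatio :
    IsContentSystem ⊤ (fun n A => densityRatio A n) (fun n => {n}) where
  content n :=
    { nonneg := fun A _ => by unfold densityRatio; positivity
      univ := by
        have h : ((Set.univ ∩ Set.Iic n).ncard : ℝ) = (n : ℝ) + 1 := by
          rw [univ_inter, ← Finset.coe_Iic, ncard_coe_finset, Nat.card_Iic]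
          push_cast
          rfl
        unfold densityRatio
        rw [h]
        exact div_self (by positivity)
      union := fun A _ A' _ hd => by
        unfold densityRatio
        rw [union_inter_distrib_right, ncard_union_eq
          (hd.mono inter_subset_left inter_subset_left)
          ((finite_Iic n).inter_of_right A) ((finite_Iic n).inter_of_right A')]
        push_cast
        ring }
  le_of_inter_subset n A _ A' _ hs := by
    unfold densityRatio
    have : (A ∩ Set.Iic n).ncard ≤ (A' ∩ Set.Iic n).ncard :=
      ncard_le_ncard (fun x hx => ⟨hs x hx.2 ⟨hx.1, rfl⟩, hx.2⟩) ((finite_Iic n).inter_of_right A')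
    gcongr
  glue _ _ := BooleanSubalgebra.mem_top
  brick_mem _ := BooleanSubalgebra.mem_top
  tendsto_brick j := by
    refine squeeze_zero (fun n => by unfold densityRatio; positivity) (fun n => ?_)
      tendsto_one_div_add_atTop_nhds_zero_nat
    unfold densityRatio
    have : (({j} ∩ Set.Iic n : Set ℕ).ncard : ℝ) ≤ 1 := by
      exact_mod_cast (ncard_le_ncard inter_subset_left (finite_singleton j)).trans
        (ncard_singleton j).le
    gcongr
  disjoint i j hij := disjoint_singleton.2 hij
  cover := iUnion_of_singleton ℕ

lemma isLimitOf_densityAlgebra {φ : RandomAlgebra → Set ℕ} (hφ : IsDensityEmbedding φ) :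
    IsLimitOf (densityAlgebra φ) ⊤ (fun n A => densityRatio A n) (fun n => {n}) :=
  isContentSystem_densityRatio.isLimitOf (ψ := φ) (S := {A | HasDensity A 0})
    (fun _ => BooleanSubalgebra.mem_top) hφ.density hφ.map_inter hφ.map_compl rfl
    (fun _ hA => ⟨BooleanSubalgebra.mem_top, Or.inl hA⟩) (fun _ _ h0 => Or.inl h0) fun _ => rfl

/-! ### The canonical construction -/

section Canonical

variable {B : ℕ → Set ℕ}

lemma enumB_injective (hB : ∀ n, (B n).Infinite) (n : ℕ) : Function.Injective (enumB B n) :=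
  Nat.nth_injective (hB n)

lemma enumB_mem (hB : ∀ n, (B n).Infinite) (n i : ℕ) : enumB B n i ∈ B n :=
  Nat.nth_mem_of_infinite (p := fun k => k ∈ B n) (hB n) i

lemma range_enumB (hB : ∀ n, (B n).Infinite) (n : ℕ) : range (enumB B n) = B n :=
  Nat.range_nth_of_infinite (p := fun k => k ∈ B n) (hB n)

lemma enumB_mem_iff (hB : ∀ n, (B n).Infinite)
    (hdisj : Pairwise (fun m n => Disjoint (B m) (B n))) {n i j : ℕ} :
    enumB B n i ∈ B j ↔ j = n := by
  refine ⟨fun h => ?_, fun h => h ▸ enumB_mem hB n i⟩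
  by_contra hne
  exact disjoint_left.1 (hdisj hne) h (enumB_mem hB n i)

lemma preimage_enumB_glue (hB : ∀ n, (B n).Infinite)
    (hdisj : Pairwise (fun m n => Disjoint (B m) (B n))) (s : ℕ → Set ℕ) (n : ℕ) :
    enumB B n ⁻¹' (⋃ j, B j ∩ s j) = enumB B n ⁻¹' s n := by
  ext i
  simp [enumB_mem_iff hB hdisj]

lemma preimage_enumB_iUnion_copyIn (hB : ∀ n, (B n).Infinite)
    (hdisj : Pairwise (fun m n => Disjoint (B m) (B n))) (C : ℕ → Set ℕ) (n : ℕ) :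
    enumB B n ⁻¹' (⋃ j, copyIn B j (C j)) = C n := by
  ext i
  simp only [mem_preimage, mem_iUnion, copyIn]
  constructor
  · rintro ⟨j, k, hk, hki⟩
    have : j = n := (enumB_mem_iff hB hdisj).1 (hki ▸ enumB_mem hB j k)
    subst this
    rwa [← enumB_injective hB j hki]
  · exact fun hi => ⟨n, i, hi, rfl⟩

/-- The sets whose trace on each `B n` is the copy of a member of the `n`-th algebra. -/
def traceAlgebra (B : ℕ → Set ℕ) (X : ℕ → MeasuredAlgebra) : BooleanSubalgebra (Set ℕ) where
  carrier := {A | ∀ n, enumB B n ⁻¹' A ∈ (X n).alg}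
  supClosed' _ hA _ hA' n := (X n).alg.sup_mem (hA n) (hA' n)
  infClosed' _ hA _ hA' n := (X n).alg.inf_mem (hA n) (hA' n)
  compl_mem' hA n := (X n).alg.compl_mem (hA n)
  bot_mem' n := (X n).alg.bot_mem

variable {X : ℕ → MeasuredAlgebra}

lemma mem_traceAlgebra {A : Set ℕ} :
    A ∈ traceAlgebra B X ↔ ∀ n, enumB B n ⁻¹' A ∈ (X n).alg := Iff.rfl

lemma mem_traceAlgebra_iff_exists_copyIn (hB : ∀ n, (B n).Infinite) {A : Set ℕ} :
    A ∈ traceAlgebra B X ↔ ∀ n, ∃ C ∈ (X n).alg, A ∩ B n = copyIn B n C := by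
  refine forall_congr' fun n => ⟨fun h => ⟨_, h, ?_⟩, ?_⟩
  · rw [copyIn, image_preimage_eq_inter_range, range_enumB hB]
  · rintro ⟨C, hC, hAC⟩
    have : enumB B n ⁻¹' A = C := by
      rw [← preimage_image_eq C (enumB_injective hB n)]
      change _ = enumB B n ⁻¹' copyIn B n C
      rw [← hAC, preimage_inter]
      exact (inter_eq_left.2 fun i _ => enumB_mem hB n i).symm
    rwa [this]

lemma copyMeas_inter (hB : ∀ n, (B n).Infinite) (n : ℕ) (A : Set ℕ) :
    copyMeas B X n (A ∩ B n) = (X n).meas (enumB B n ⁻¹' A) := by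
  unfold copyMeas
  congr 1
  ext i
  exact and_iff_left (enumB_mem hB n i)

lemma isContentSystem_canonical (hB : ∀ n, (B n).Infinite)
    (hdisj : Pairwise (fun m n => Disjoint (B m) (B n))) (hcov : (⋃ n, B n) = Set.univ)
    (hX : ∀ n, IsContent (X n).alg (X n).meas) :
    IsContentSystem (traceAlgebra B X) (fun n A => (X n).meas (enumB B n ⁻¹' A)) B where
  content n :=
    { nonneg := fun A hA => (hX n).nonneg _ (hA n)
      univ := (hX n).univ
      union := fun A hA A' hA' hd => (hX n).union _ (hA n) _ (hA' n) (hd.preimage _) }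
  le_of_inter_subset n A hA A' hA' hs := (hX n).mono (hA n) (hA' n)
    fun i hi => hs n le_rfl ⟨hi, enumB_mem hB n i⟩
  glue s hs n := by
    rw [preimage_enumB_glue hB hdisj]
    exact hs n n
  brick_mem j n := by
    by_cases h : j = n
    · have : enumB B n ⁻¹' B j = ⊤ := eq_univ_of_forall fun i => (enumB_mem_iff hB hdisj).2 h
      exact this ▸ (X n).alg.top_mem
    · have : enumB B n ⁻¹' B j = ⊥ :=
        eq_empty_of_forall_notMem fun i hi => h ((enumB_mem_iff hB hdisj).1 hi)
      exact this ▸ (X n).alg.bot_mem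
  tendsto_brick j := by
    refine tendsto_const_nhds.congr' ?_
    filter_upwards [eventually_gt_atTop j] with n hn
    have : enumB B n ⁻¹' B j = ∅ :=
      eq_empty_of_forall_notMem fun i hi => hn.ne ((enumB_mem_iff hB hdisj).1 hi)
    rw [this, (hX n).empty]
  disjoint := hdisj
  cover := hcov

lemma isLimitOf_canonicalPair (hB : ∀ n, (B n).Infinite)
    (hdisj : Pairwise (fun m n => Disjoint (B m) (B n))) (hcov : (⋃ n, B n) = Set.univ)
    (hX : ∀ n, IsContent (X n).alg (X n).meas) {φ : ℕ → RandomAlgebra → Set ℕ}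
    (hφ : ∀ n, IsMetricIso (φ n) (X n)) :
    IsLimitOf (canonicalPair B X φ) (traceAlgebra B X)
      (fun n A => (X n).meas (enumB B n ⁻¹' A)) B := by
  have hsys := isContentSystem_canonical hB hdisj hcov hX
  have hF : familyF B X = {A | A ∈ traceAlgebra B X ∧
      Tendsto (fun n => (X n).meas (enumB B n ⁻¹' A)) atTop (𝓝 1)} := by
    ext A
    simp only [familyF, mem_ofPred_eq, mem_traceAlgebra_iff_exists_copyIn hB, copyMeas_inter hB]
  have hpre : ∀ M n, enumB B n ⁻¹' (⋃ j, copyIn B j (φ j M)) = φ n M := fun M n =>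
    preimage_enumB_iUnion_copyIn hB hdisj (fun j => φ j M) n
  refine hsys.isLimitOf (ψ := fun M => ⋃ n, copyIn B n (φ n M)) (S := familyF B X)
    (fun M n => ?_) (fun M => ?_) (fun M N => ?_) (fun M => ?_) rfl ?_ ?_ (fun A => ?_)
  · rw [hpre]
    exact (hφ n).mem M
  · simp only [hpre, (hφ _).meas_eq, tendsto_const_nhds]
  · refine tendsto_const_nhds.congr fun n => ?_
    rw [preimage_symmDiff, preimage_inter, hpre, hpre, hpre, (hφ n).map_inter]
  · refine tendsto_const_nhds.congr fun n => ?_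
    rw [preimage_symmDiff, preimage_compl, hpre, hpre, (hφ n).map_compl]
  · rw [hF]
    exact fun A hA => ⟨hA.1, Or.inr hA.2⟩
  · rw [hF]
    refine fun A hA h0 => Or.inr ⟨(traceAlgebra B X).compl_mem hA, ?_⟩
    simp only [(hsys.content _).compl hA]
    simpa using h0.const_sub 1
  · simp only [canonicalPair, copyMeas_inter hB]

lemma IsStage.one_le {α : Ordinal.{0}} {X : MeasuredAlgebra} (h : IsStage B α X) : 1 ≤ α := by
  induction h with
  | one => exact le_rfl
  | step α a X φ _ lt _ _ _ ih => exact (ih 0).trans (lt 0).le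

/-- Every stage carries the limit of a sequence of measures adapted to its bricks. -/
lemma IsStage.exists_isLimitOf (hB : ∀ n, (B n).Infinite)
    (hdisj : Pairwise (fun m n => Disjoint (B m) (B n))) (hcov : (⋃ n, B n) = Set.univ)
    {α : Ordinal.{0}} {X : MeasuredAlgebra} (h : IsStage B α X) :
    ∃ 𝒜 m, IsLimitOf X 𝒜 m (brick B α) := by
  induction h with
  | one φ hφ =>
    have : brick B 1 = fun n => {n} := by
      funext n
      simp [brick]
    rw [this]
    exact ⟨_, _, isLimitOf_densityAlgebra hφ⟩
  | step α a X φ _ lt _ stage iso ih =>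
    have hα : α ≠ 1 := ((stage 0).one_le.trans_lt (lt 0)).ne'
    have : brick B α = B := by
      funext n
      simp [brick, hα]
    rw [this]
    refine ⟨_, _, isLimitOf_canonicalPair hB hdisj hcov (fun n => ?_) iso⟩
    obtain ⟨_, _, hn⟩ := ih n
    exact hn.isContent

end Canonical

theorem lemma3p9 (B : ℕ → Set ℕ) (hB : ∀ n, (B n).Infinite)
    (hdisj : Pairwise (fun m n => Disjoint (B m) (B n))) (hcov : (⋃ n, B n) = Set.univ)
    (α : Ordinal.{0}) (hα : 1 ≤ α) (hα' : α < Ordinal.omega 1)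
    (X : MeasuredAlgebra) (hX : IsStage B α X)
    (V : Set X.Space) (hV : V.Countable)
    (hVdisj : Disjoint V ((⋃ n, X.hat (brick B α n)) ∪ X.support)) :
    ∃ E : Set X.Space, IsClosed E ∧ ExtremallyDisconnected E ∧ V ⊆ E := by
  obtain ⟨_, _, h⟩ := hX.exists_isLimitOf hB hdisj hcov
  exact h.exists_closed_extremallyDisconnected hV hVdisj
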